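/- Let $(\Omega,\mathcal F,(\mathcal F_t)_{t\ge 0},P)$ be a filtered probability space satisfying the usual conditions and supporting a Brownian motion $W$. The unaffected price is the positive solution of $d\bar S_t=\bar S_t(\mu_t\,dt+\sigma\,dW_t)$, $\bar S_0=s_0>0$, with $\sigma>0$ constant and $\mu$ bounded and progressive. Let $f:\mathbb R\to(0,\infty)$ be nondecreasing and $C^1$ with $f(0)=1$, $\lambda=f'/f$, $F(x)=\int_0^x f(u)\,du$, and let $h:\mathbb R\to\mathbb R$ be Lipschitz with $\operatorname{sgn}(x)h(x)\ge 0$. An adapted càdlàg strategy $\Theta$ on $[0,T]$ with $\Theta_{0-}=0$ has the impact process $dY_t=-h(Y_t)\,dt+d\Theta_t$, $Y_{0-}=y_0\in\mathbb R$, moves the price to $S_t=f(Y_t)\bar S_t$, and generates the proceeds $$L_t(\Theta)=\int_0^t F(Y_u)\,d\bar S_u-\int_0^t\bar S_u f(Y_u)h(Y_u)\,du-\big(\bar S_tF(Y_t)-\bar S_0F(Y_{0-})\big).$$ Let $\Gamma$ be a class of adapted càdlàg strategies on $[0,T]$ ($T\ge 0$) that is stable under adding a jump at terminal time: $\Theta+\Delta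 1_{\{T\}}\in\Gamma$ for every $\Theta\in\Gamma$ and every $\mathcal F_T$-measurable real random variable $\Delta$. For measurable $(g_0,g_1):(0,\infty)\times\mathbb R\to\mathbb R^2$, let the superhedging price $p_{(g_0,g_1)}\in[-\infty,\infty]$ be the infimum of all $\beta_{0-}\in\mathbb R$ for which there is $\Theta\in\Gamma$ with $\Theta_{0-}=0$ such that $\beta=\beta_{0-}+L(\Theta)$ satisfies, almost surely, $\beta_T\ge g_0(S_T,Y_T)$ and $\Theta_T=g_1(S_T,Y_T)$ (with $\inf\emptyset=+\infty$). For $(s,y)\in(0,\infty)\times\mathbb R$ put $$H(s,y)=\inf\Big\{g_0\Big(s\tfrac{f(y+\theta)}{f(y)},y+\theta\Big)+s\,\tfrac{F(y+\theta)-F(y)}{f(y)}\ :\ \theta\in\mathbb R,\ \theta=g_1\Big(s\tfrac{f(y+\theta)}{f(y)},y+\theta\Big)\Big\}\in[-\infty,\infty].$$ (i) If $H$ is finite everywhere on $(0,\infty)\times\mathbb R$ and Borel measurable, then $p_{(g_0,g_1)}=p_{(H,0)}$. (ii) If $\lambda$ is constant and $g_0,g_1$ do not depend on $y$, then $H$ does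 not depend on $y$. -/

import Mathlib

open MeasureTheory ProbabilityTheory Filter Topology
open scoped NNReal

noncomputable section

namespace TransientImpact

/-- The usual conditions: the filtration is right-continuous and its initial sigma-algebra contains
all `P`-null sets. -/
structure UsualConditions {Ω : Type*} {mΩ : MeasurableSpace Ω} (P : Measure Ω)
    (ℱ : Filtration ℝ≥0 mΩ) : Prop where
  rightContinuous : ℱ.IsRightContinuous
  complete : ∀ s : Set Ω, P s = 0 → MeasurableSet[ℱ 0] s

/-- `W` is a Brownian motion with respect to the filtration `ℱ`. -/
structure IsBrownianMotion {Ω : Type*} {mΩ : MeasurableSpace Ω} (P : Measure Ω)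
    (ℱ : Filtration ℝ≥0 mΩ) (W : ℝ≥0 → Ω → ℝ) : Prop where
  brownian : IsBrownianReal W P
  adapted : Adapted ℱ W
  indep : ∀ s t : ℝ≥0, s ≤ t →
    Indep (MeasurableSpace.comap (fun ω => W t ω - W s ω) inferInstance) (ℱ s) P

/-- All paths of `X` are càdlàg on `[0,T]`; values after time `T` are irrelevant. -/
def CadlagOn {Ω : Type*} (T : ℝ≥0) (X : ℝ≥0 → Ω → ℝ) : Prop :=
  ∀ ω, (∀ t, t < T → ContinuousWithinAt (fun u => X u ω) (Set.Ici t) t) ∧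
    (∀ t, 0 < t → t ≤ T → ∃ l : ℝ, Tendsto (fun u => X u ω) (𝓝[<] t) (𝓝 l))

/-- The random variable `J` is the stochastic integral `∫₀ᵗ X₋ dM`: it is the limit in probability
of the non-anticipating Riemann sums `∑ X_{τᵢ} (M_{τᵢ₊₁} - M_{τᵢ})` over the partitions
`0 = τ₀ ≤ ⋯ ≤ τ_N = t` of `[0,t]` as their mesh tends to zero. It is used for adapted càdlàg
integrands `X` and continuous semimartingales `M`, and determines `J` up to null sets. -/
def IsStochIntegralAt {Ω : Type*} {mΩ : MeasurableSpace Ω} (P : Measure Ω)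
    (X M : ℝ≥0 → Ω → ℝ) (t : ℝ≥0) (J : Ω → ℝ) : Prop :=
  ∀ ε : ℝ, 0 < ε → ∃ δ : ℝ, 0 < δ ∧ ∀ (N : ℕ) (τ : ℕ → ℝ≥0),
    Monotone τ → τ 0 = 0 → τ N = t → (∀ i < N, (τ (i + 1) : ℝ) - (τ i : ℝ) ≤ δ) →
    P {ω | ε ≤ |(∑ i ∈ Finset.range N, X (τ i) ω * (M (τ (i + 1)) ω - M (τ i) ω)) - J ω|}
      ≤ ENNReal.ofReal ε

/-- The price impact function: positive, increasing, continuously differentiable, `f 0 = 1`. -/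
structure IsImpactFunction (f : ℝ → ℝ) : Prop where
  pos : ∀ x, 0 < f x
  mono : Monotone f
  contDiff : ContDiff ℝ 1 f
  map_zero : f 0 = 1

/-- `λ = f' / f`. -/
def lam (f : ℝ → ℝ) (x : ℝ) : ℝ := deriv f x / f x

/-- The antiderivative `F(x) = ∫₀ˣ f(u) du`. -/
def antideriv (f : ℝ → ℝ) (x : ℝ) : ℝ := ∫ u in (0 : ℝ)..x, f u

/-- The resilience function: Lipschitz with `sgn(x) h(x) ≥ 0`. -/
structure IsResilience (h : ℝ → ℝ) : Prop where
  lipschitz : ∃ K : ℝ≥0, LipschitzWith K h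
  sign : ∀ x, 0 ≤ Real.sign x * h x

/-- The market model: a Brownian motion `W`, the unaffected price `Sbar`, which is a positive
continuous adapted process with `dSbar = Sbar (μ dt + σ dW)` and `Sbar_0 = s₀`, the impact function
`f`, the resilience function `h`, and the level of impact `y₀ = Y_{0-}` before trading starts. -/
structure Market {Ω : Type*} {mΩ : MeasurableSpace Ω} (P : Measure Ω)
    (ℱ : Filtration ℝ≥0 mΩ) where
  W : ℝ≥0 → Ω → ℝ
  μ : ℝ≥0 → Ω → ℝ
  σ : ℝ
  s₀ : ℝ
  Sbar : ℝ≥0 → Ω → ℝ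
  f : ℝ → ℝ
  h : ℝ → ℝ
  y₀ : ℝ
  brownian : IsBrownianMotion P ℱ W
  drift_progressive : IsProgressive ℱ μ
  drift_bounded : ∃ C : ℝ, ∀ t ω, |μ t ω| ≤ C
  σ_pos : 0 < σ
  s₀_pos : 0 < s₀
  Sbar_pos : ∀ t ω, 0 < Sbar t ω
  Sbar_continuous : ∀ ω, Continuous (fun t => Sbar t ω)
  Sbar_adapted : Adapted ℱ Sbar
  Sbar_sde : ∃ I : ℝ≥0 → Ω → ℝ,
    (∀ t, IsStochIntegralAt P (fun u ω => σ * Sbar u ω) W t (I t)) ∧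
    ∀ t, ∀ᵐ ω ∂P, Sbar t ω =
      s₀ + (∫ u in (0 : ℝ)..(t : ℝ), Sbar u.toNNReal ω * μ u.toNNReal ω) + I t ω
  impact : IsImpactFunction f
  resilience : IsResilience h

namespace Market

variable {Ω : Type*} {mΩ : MeasurableSpace Ω} {P : Measure Ω} {ℱ : Filtration ℝ≥0 mΩ}

/-- `Y` is the market impact process of the strategy `Θ` with `Θ_{0-} = 0`, on `[0,T]`:
`dY = -h(Y) dt + dΘ`, `Y_{0-} = y₀`, pathwise. -/
structure IsImpact (𝓜 : Market P ℱ) (T : ℝ≥0) (Θ Y : ℝ≥0 → Ω → ℝ) : Prop where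
  adapted : Adapted ℱ Y
  cadlag : CadlagOn T Y
  eq : ∀ ω, ∀ t ≤ T,
    Y t ω = 𝓜.y₀ + Θ t ω - ∫ u in (0 : ℝ)..(t : ℝ), 𝓜.h (Y u.toNNReal ω)

/-- The price `S = f(Y) Sbar` of the risky asset under the impact `Y`. -/
def price (𝓜 : Market P ℱ) (Y : ℝ≥0 → Ω → ℝ) (t : ℝ≥0) (ω : Ω) : ℝ :=
  𝓜.f (Y t ω) * 𝓜.Sbar t ω

/-- `L` is the process of proceeds, on `[0,T]`, of a strategy with impact process `Y`:
`L_t = ∫₀ᵗ F(Y) dSbar - ∫₀ᵗ Sbar (f h)(Y) du - (Sbar_t F(Y_t) - Sbar_0 F(Y_{0-}))`. -/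
structure IsProceeds (𝓜 : Market P ℱ) (T : ℝ≥0) (Y L : ℝ≥0 → Ω → ℝ) : Prop where
  adapted : Adapted ℱ L
  cadlag : CadlagOn T L
  eq : ∃ J : ℝ≥0 → Ω → ℝ,
    (∀ t ≤ T, IsStochIntegralAt P (fun u ω => antideriv 𝓜.f (Y u ω)) 𝓜.Sbar t (J t)) ∧
    ∀ t ≤ T, ∀ᵐ ω ∂P, L t ω = J t ω
      - (∫ u in (0 : ℝ)..(t : ℝ),
          𝓜.Sbar u.toNNReal ω * (𝓜.f (Y u.toNNReal ω) * 𝓜.h (Y u.toNNReal ω)))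
      - (𝓜.Sbar t ω * antideriv 𝓜.f (Y t ω) - 𝓜.Sbar 0 ω * antideriv 𝓜.f 𝓜.y₀)

/-- `(β, Θ)` is a superhedging strategy with initial capital `b = β_{0-}` for the payoff
`(g₀, g₁)` at maturity `T`: `Θ ∈ Γ` starts from `Θ_{0-} = 0`, the strategy is self-financing,
`β = b + L(Θ)`, and almost surely `β_T ≥ g₀(S_T, Y_T)` and `Θ_T = g₁(S_T, Y_T)`. -/
def IsSuperhedge (𝓜 : Market P ℱ) (T : ℝ≥0) (Γ : Set (ℝ≥0 → Ω → ℝ)) (g₀ g₁ : ℝ → ℝ → ℝ)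
    (b : ℝ) (β Θ : ℝ≥0 → Ω → ℝ) : Prop :=
  Θ ∈ Γ ∧ ∃ Y L : ℝ≥0 → Ω → ℝ, 𝓜.IsImpact T Θ Y ∧ 𝓜.IsProceeds T Y L ∧
    (∀ t ω, β t ω = b + L t ω) ∧
    ∀ᵐ ω ∂P, g₀ (𝓜.price Y T ω) (Y T ω) ≤ β T ω ∧ Θ T ω = g₁ (𝓜.price Y T ω) (Y T ω)

/-- The superhedging price `p_{(g₀, g₁)}`: the infimum of the initial capitals of superhedging
strategies, in `[-∞, ∞]` (it is `+∞` if there is no superhedging strategy). -/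
def superhedgingPrice (𝓜 : Market P ℱ) (T : ℝ≥0) (Γ : Set (ℝ≥0 → Ω → ℝ))
    (g₀ g₁ : ℝ → ℝ → ℝ) : EReal :=
  ⨅ (b : ℝ) (_ : ∃ β Θ : ℝ≥0 → Ω → ℝ, 𝓜.IsSuperhedge T Γ g₀ g₁ b β Θ), (b : EReal)

end Market

/-- `Γ` is a class of trading strategies on `[0,T]`: adapted càdlàg processes. -/
def IsStrategyClass {Ω : Type*} {mΩ : MeasurableSpace Ω} (ℱ : Filtration ℝ≥0 mΩ) (T : ℝ≥0)
    (Γ : Set (ℝ≥0 → Ω → ℝ)) : Prop :=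
  ∀ Θ ∈ Γ, Adapted ℱ Θ ∧ CadlagOn T Θ

/-- `Γ` is stable under adding a jump at terminal time: `Θ + Δ 1_{T} ∈ Γ` for all `Θ ∈ Γ` and all
`ℱ_T`-measurable `Δ`. -/
def StableUnderTerminalJump {Ω : Type*} {mΩ : MeasurableSpace Ω} (ℱ : Filtration ℝ≥0 mΩ) (T : ℝ≥0)
    (Γ : Set (ℝ≥0 → Ω → ℝ)) : Prop :=
  ∀ Θ ∈ Γ, ∀ Δ : Ω → ℝ, Measurable[ℱ T] Δ →
    (fun t ω => Θ t ω + Set.indicator {T} (fun _ => Δ ω) t) ∈ Γ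

/-- A function of `(s, y)` is measurable on `(0,∞) × ℝ`. -/
def PayoffMeasurable (g : ℝ → ℝ → ℝ) : Prop :=
  Measurable (fun p : Set.Ioi (0 : ℝ) × ℝ => g p.1 p.2)

/-- The minimal cash `H(s,y)` needed to meet `(g₀, g₁)` with one block trade at maturity, when
just before that trade the price is `s`, the impact is `y`, and no risky asset is held; an
infimum in `[-∞, ∞]`, equal to `+∞` if no block trade meets the payoff. -/
def cashEquivalent (f : ℝ → ℝ) (g₀ g₁ : ℝ → ℝ → ℝ) (s y : ℝ) : EReal :=
  ⨅ (θ : ℝ) (_ : θ = g₁ (s * (f (y + θ) / f y)) (y + θ)),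
    ((g₀ (s * (f (y + θ) / f y)) (y + θ)
      + s * ((antideriv f (y + θ) - antideriv f y) / f y) : ℝ) : EReal)

end TransientImpact

end

/-! A block trade `Δ` at `T` moves the state to `(f(Y_T+Δ) S̄_T, Y_T+Δ)` and costs exactly `S̄_T
(F(Y_T+Δ) - F(Y_T))`, since no time integral sees a jump at `T`. Any strategy can thus be split into
what precedes its last trade and that trade, whose least cost is `H`. Liquidating a hedge of `(g₀,
g₁)` at `T` leads to a state from which buying `Θ_T` back is admissible in the infimum defining `H`;
hence `p_(H,0) ≤ p_(g₀,g₁)`. Conversely, a hedge of `(H, 0)` is completed by an `ε`-optimal block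
trade. It must be `ℱ_T`-measurable, so it is chosen as a Borel function of `(S_T, Y_T)`, up to a
null set of their law, by `exists_measurable_ae_mem`. For (ii), constant `λ` forces `f` to be
exponential, and `y` cancels from both ratios in `H`. -/

/-! ### Measurable selection almost everywhere. -/

open Set PiNat in
/-- A continuous surjection from the Baire space has a measurable section outside a null set. -/
theorem exists_measurable_ae_rightInverse {X : Type*} [TopologicalSpace X] [RegularSpace X]
    [T2Space X] [MeasurableSpace X] [OpensMeasurableSpace X] (μ : Measure X) [IsFiniteMeasure μ]
    {p : (ℕ → ℕ) → X} (hp : Continuous p) (hsurj : Function.Surjective p) :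
    ∃ s : X → ℕ → ℕ, Measurable s ∧ ∀ᵐ x ∂μ, p (s x) = x := by
  classical
  -- the image of the cylinder of sequences with initial word `w` (written backwards), and its hull
  let A : List ℕ → Set X := fun w => p '' {σ | res σ w.length = w}
  let B : List ℕ → Set X := fun w => toMeasurable μ (A w) ∩ closure (A w)
  have hA : ∀ w, A w = ⋃ n, A (n :: w) := by
    intro w
    ext x
    simp only [A, mem_image, mem_ofPred_eq, mem_iUnion, List.length_cons, res_succ,
      List.cons.injEq]
    constructor
    · rintro ⟨σ, h, rfl⟩
      exact ⟨_, σ, ⟨rfl, h⟩, rfl⟩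
    · rintro ⟨n, σ, ⟨-, h⟩, rfl⟩
      exact ⟨σ, h, rfl⟩
  have hAB : ∀ w, A w ⊆ B w := fun w =>
    subset_inter (subset_toMeasurable _ _) subset_closure
  have hBmeas : ∀ w, MeasurableSet (B w) := fun w =>
    (measurableSet_toMeasurable _ _).inter isClosed_closure.measurableSet
  -- `A w` need not be measurable, but the sets `B (n :: w)` cover it; a measurable hull has no more
  -- mass than `A w`, so they cover almost all of the hull.
  have hnull : ∀ w, ∀ᵐ x ∂μ, x ∈ B w → ∃ n, x ∈ B (n :: w) := by
    intro w
    have hV : MeasurableSet (⋃ n, B (n :: w)) := .iUnion fun n => hBmeas _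
    have hAV : A w ⊆ ⋃ n, B (n :: w) := by
      rw [hA]
      exact iUnion_mono fun n => hAB _
    have hle : μ (toMeasurable μ (A w)) ≤ μ (toMeasurable μ (A w) ∩ ⋃ n, B (n :: w)) := by
      rw [measure_toMeasurable]
      exact measure_mono (subset_inter (subset_toMeasurable _ _) hAV)
    have hdiff : μ (toMeasurable μ (A w) \ ⋃ n, B (n :: w)) = 0 := by
      have h1 := measure_inter_add_sdiff (μ := μ) (toMeasurable μ (A w)) hV
      have h2 : μ (toMeasurable μ (A w) ∩ ⋃ n, B (n :: w)) ≠ ⊤ := measure_ne_top _ _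
      refine le_antisymm ?_ zero_le
      refine (ENNReal.add_le_add_iff_left h2).1 ?_
      rw [h1, add_zero]
      exact hle
    filter_upwards [measure_eq_zero_iff_ae_notMem.1 hdiff] with x hx hxB
    by_contra hcon
    exact hx ⟨hxB.1, by simpa using hcon⟩
  -- the greedy choice of the next letter, and the words and sequence obtained from it
  let q : List ℕ → X → ℕ → Prop := fun w x n => x ∈ B (n :: w) ∨ ∀ m, x ∉ B (m :: w)
  -- The second alternative of `q` only makes the choice total: it gives the letter `0` when no
  -- extension of `w` works.
  have hq : ∀ w x, ∃ n, q w x n := by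
    intro w x
    by_cases h : ∃ n, x ∈ B (n :: w)
    · exact h.imp fun n hn => Or.inl hn
    · exact ⟨0, Or.inr (by simpa using h)⟩
  let c : List ℕ → X → ℕ := fun w x => Nat.find (hq w x)
  have hc : ∀ w, Measurable (c w) := fun w => measurable_find (hq w) fun k => by
    have : {x | q w x k} = B (k :: w) ∪ ⋂ m, (B (m :: w))ᶜ := by
      ext x
      simp [q]
    rw [this]
    exact (hBmeas _).union (.iInter fun m => (hBmeas _).compl)
  let word : X → ℕ → List ℕ := fun x k => Nat.rec [] (fun _ w => c w x :: w) k
  let s : X → ℕ → ℕ := fun x k => c (word x k) x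
  have hres : ∀ x k, res (s x) k = word x k := by
    intro x k
    induction k with
    | zero => rfl
    | succ k ih => rw [res_succ, ih]
  have hword : ∀ k w, MeasurableSet {x | word x k = w} := by
    intro k
    induction k with
    | zero => exact fun w => .const ([] = w)
    | succ k ih =>
      intro w
      have : {x | word x (k + 1) = w} = ⋃ v, {x | word x k = v} ∩ {x | c v x :: v = w} := by
        ext x
        simp [word]
      rw [this]
      exact .iUnion fun v => (ih v).inter
        ((hc v) (MeasurableSpace.measurableSet_top (s := {n | n :: v = w})))
  refine ⟨s, measurable_pi_lambda _ fun k => measurable_to_countable' fun n => ?_, ?_⟩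
  · have : (fun x => s x k) ⁻¹' {n} = ⋃ v, {x | word x k = v} ∩ c v ⁻¹' {n} := by
      ext x
      simp [s]
    rw [this]
    exact .iUnion fun v => (hword k v).inter (hc v (measurableSet_singleton n))
  · filter_upwards [ae_all_iff.2 hnull] with x hx
    have hmem : ∀ k, x ∈ B (word x k) := by
      intro k
      induction k with
      | zero =>
        obtain ⟨σ, rfl⟩ := hsurj x
        exact hAB _ ⟨σ, rfl, rfl⟩
      | succ k ih =>
        have h1 := hx _ ih
        rcases Nat.find_spec (hq (word x k) x) with h2 | h2
        · exact h2
        · exact absurd h1 (by simpa using h2)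
    -- The closures in `B` identify the limit: by continuity a short enough cylinder around `s x`
    -- maps into a closed neighbourhood of `p (s x)` missing `x`, whereas `x` lies in the closure of
    -- that image.
    by_contra hne
    obtain ⟨U, hU, hUx⟩ : ∃ U ∈ 𝓝 (p (s x)), IsClosed U ∧ x ∉ U := by
      obtain ⟨U, hU, hUc, hUs⟩ := exists_mem_nhds_isClosed_subset
        (isOpen_compl_singleton.mem_nhds (show p (s x) ∈ ({x} : Set X)ᶜ from hne))
      exact ⟨U, hU, hUc, fun h => hUs h rfl⟩
    obtain ⟨V, hV, hVo, hsV⟩ := mem_nhds_iff.1 (hp.continuousAt.preimage_mem_nhds hU)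
    obtain ⟨C, ⟨τ, k, rfl⟩, hsC, hCV⟩ :=
      (isTopologicalBasis_cylinders (fun _ : ℕ => ℕ)).exists_subset_of_mem_open hsV hVo
    have hlen : (word x k).length = k := by rw [← hres, res_length]
    have hsub : A (word x k) ⊆ U := by
      rintro _ ⟨σ, hσ, rfl⟩
      refine hV (hCV ?_)
      rw [mem_ofPred_eq, hlen, ← hres] at hσ
      rw [cylinder_eq_res] at hsC ⊢
      exact hσ.trans hsC
    exact hUx.2 (closure_minimal hsub hUx.1 (hmem k).2)

/-- Measurable selection outside a null set: a Borel set all of whose sections are nonempty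
contains the graph of a measurable function, up to a null set. -/
theorem exists_measurable_ae_mem {X Y : Type*} [MeasurableSpace X] [StandardBorelSpace X]
    [MeasurableSpace Y] [StandardBorelSpace Y] (μ : Measure X) [IsFiniteMeasure μ]
    {E : Set (X × Y)} (hE : MeasurableSet E) (hne : ∀ x, ∃ y, (x, y) ∈ E) :
    ∃ θ : X → Y, Measurable θ ∧ ∀ᵐ x ∂μ, (x, θ x) ∈ E := by
  let := upgradeStandardBorel X
  let := upgradeStandardBorel Y
  rcases isEmpty_or_nonempty X with hX | ⟨⟨x₀⟩⟩
  · exact ⟨hX.elim, measurable_of_empty _, ae_of_all _ hX.elim⟩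
  have hA := hE.analyticSet
  rw [AnalyticSet] at hA
  rcases hA with h | ⟨φ, hφ, hφE⟩
  · obtain ⟨y, hy⟩ := hne x₀
    simp [h] at hy
  -- Nonempty sections make the first coordinate of the parametrization of `E` surjective; the
  -- second coordinate along its section is the selection.
  obtain ⟨s, hs, hps⟩ := exists_measurable_ae_rightInverse μ (continuous_fst.comp hφ) (by
    intro x
    obtain ⟨y, hy⟩ := hne x
    rw [← hφE] at hy
    obtain ⟨σ, hσ⟩ := hy
    exact ⟨σ, by simp [hσ]⟩)
  refine ⟨fun x => (φ (s x)).2, (continuous_snd.comp hφ).measurable.comp hs, ?_⟩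
  filter_upwards [hps] with x hx
  have : (x, (φ (s x)).2) = φ (s x) := Prod.ext hx.symm rfl
  rw [this, ← hφE]
  exact Set.mem_range_self _

namespace TransientImpact

variable {Ω : Type*} {mΩ : MeasurableSpace Ω} {P : Measure Ω} {ℱ : Filtration ℝ≥0 mΩ}

/-! ### Effect of a terminal jump. -/

/-- The process `X + Δ 1_{T}`. -/
noncomputable def addTerminalJump (T : ℝ≥0) (X : ℝ≥0 → Ω → ℝ) (Δ : Ω → ℝ) (t : ℝ≥0) (ω : Ω) : ℝ :=
  X t ω + Set.indicator {T} (fun _ => Δ ω) t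

theorem addTerminalJump_self (T : ℝ≥0) (X : ℝ≥0 → Ω → ℝ) (Δ : Ω → ℝ) (ω : Ω) :
    addTerminalJump T X Δ T ω = X T ω + Δ ω := by
  simp [addTerminalJump]

theorem addTerminalJump_of_ne {T t : ℝ≥0} (ht : t ≠ T) (X : ℝ≥0 → Ω → ℝ) (Δ : Ω → ℝ) (ω : Ω) :
    addTerminalJump T X Δ t ω = X t ω := by
  simp [addTerminalJump, ht]

theorem adapted_addTerminalJump {T : ℝ≥0} {X : ℝ≥0 → Ω → ℝ} {Δ : Ω → ℝ}
    (hX : Adapted ℱ X) (hΔ : Measurable[ℱ T] Δ) : Adapted ℱ (addTerminalJump T X Δ) := by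
  intro t
  by_cases ht : t = T
  · subst ht
    have : addTerminalJump t X Δ t = fun ω => X t ω + Δ ω :=
      funext fun ω => addTerminalJump_self t X Δ ω
    rw [this]
    exact (hX t).add hΔ
  · have : addTerminalJump T X Δ t = X t := funext fun ω => addTerminalJump_of_ne ht X Δ ω
    rw [this]
    exact hX t

theorem CadlagOn.addTerminalJump {T : ℝ≥0} {X : ℝ≥0 → Ω → ℝ} (hX : CadlagOn T X) (Δ : Ω → ℝ) :
    CadlagOn T (addTerminalJump T X Δ) := by
  intro ω
  refine ⟨fun t ht => ?_, fun t h0 ht => ?_⟩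
  · refine ((hX ω).1 t ht).congr_of_eventuallyEq ?_ (addTerminalJump_of_ne ht.ne X Δ ω)
    filter_upwards [mem_nhdsWithin_of_mem_nhds (Iio_mem_nhds ht)] with u hu
    exact addTerminalJump_of_ne (ne_of_lt hu) X Δ ω
  · obtain ⟨l, hl⟩ := (hX ω).2 t h0 ht
    refine ⟨l, hl.congr' ?_⟩
    filter_upwards [self_mem_nhdsWithin] with u hu
    exact (addTerminalJump_of_ne (ne_of_lt (lt_of_lt_of_le hu ht)) X Δ ω).symm

/-- A terminal jump does not affect Lebesgue integrals in time. -/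
theorem integral_addTerminalJump (T t : ℝ≥0) (X : ℝ≥0 → Ω → ℝ) (Δ : Ω → ℝ) (ω : Ω)
    (k : ℝ → ℝ → ℝ) :
    ∫ u in (0 : ℝ)..t, k u (addTerminalJump T X Δ u.toNNReal ω) =
      ∫ u in (0 : ℝ)..t, k u (X u.toNNReal ω) := by
  refine intervalIntegral.integral_congr_ae ?_
  have hT : ∀ᵐ u : ℝ, u ≠ T := by simp [ae_iff]
  filter_upwards [hT] with u hu hmem
  rw [Set.uIoc_of_le t.coe_nonneg] at hmem
  rw [addTerminalJump_of_ne]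
  rintro rfl
  exact hu (Real.coe_toNNReal u hmem.1.le).symm

/-- The stochastic integral up to time `t` only depends on the integrand before time `t`. -/
theorem IsStochIntegralAt.congr_of_lt {X X' M : ℝ≥0 → Ω → ℝ} {t : ℝ≥0} {J : Ω → ℝ}
    (hJ : IsStochIntegralAt P X M t J) (hX : ∀ u < t, X' u = X u) :
    IsStochIntegralAt P X' M t J := by
  intro ε hε
  obtain ⟨δ, hδ, h⟩ := hJ ε hε
  refine ⟨δ, hδ, fun N τ hτ h0 hN hmesh => ?_⟩
  have hsum : ∀ ω, ∑ i ∈ Finset.range N, X' (τ i) ω * (M (τ (i + 1)) ω - M (τ i) ω) =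
      ∑ i ∈ Finset.range N, X (τ i) ω * (M (τ (i + 1)) ω - M (τ i) ω) := by
    intro ω
    refine Finset.sum_congr rfl fun i hi => ?_
    have h1 : τ i ≤ τ (i + 1) := hτ i.le_succ
    have h2 : τ (i + 1) ≤ t := hN ▸ hτ (Finset.mem_range.1 hi)
    -- A node already at `t` contributes nothing, its increment of `M` being zero.
    rcases (h1.trans h2).lt_or_eq with hlt | heq
    · rw [hX _ hlt]
    · rw [le_antisymm h2 (heq ▸ h1), heq]
      simp
  simp only [hsum]
  exact h N τ hτ h0 hN hmesh

theorem IsImpactFunction.continuous {f : ℝ → ℝ} (hf : IsImpactFunction f) : Continuous f :=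
  hf.contDiff.continuous

theorem IsImpactFunction.continuous_antideriv {f : ℝ → ℝ} (hf : IsImpactFunction f) :
    Continuous (antideriv f) :=
  intervalIntegral.continuous_primitive (fun _ _ => hf.continuous.intervalIntegrable _ _) 0

namespace Market

variable {𝓜 : Market P ℱ} {T : ℝ≥0} {Θ Y L : ℝ≥0 → Ω → ℝ} {Δ : Ω → ℝ}

theorem price_pos (𝓜 : Market P ℱ) (Y : ℝ≥0 → Ω → ℝ) (t : ℝ≥0) (ω : Ω) : 0 < 𝓜.price Y t ω :=
  mul_pos (𝓜.impact.pos _) (𝓜.Sbar_pos t ω)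

theorem IsImpact.addTerminalJump (hY : 𝓜.IsImpact T Θ Y) (hΔ : Measurable[ℱ T] Δ) :
    𝓜.IsImpact T (addTerminalJump T Θ Δ) (addTerminalJump T Y Δ) where
  adapted := adapted_addTerminalJump hY.adapted hΔ
  cadlag := hY.cadlag.addTerminalJump Δ
  eq ω t ht := by
    rw [integral_addTerminalJump T t Y Δ ω fun _ => 𝓜.h]
    simp only [TransientImpact.addTerminalJump]
    rw [hY.eq ω t ht]
    ring

/-- The cost of a block trade of size `Δ` at time `T`. -/
noncomputable def blockCost (𝓜 : Market P ℱ) (T : ℝ≥0) (Y : ℝ≥0 → Ω → ℝ) (Δ : Ω → ℝ) (ω : Ω) : ℝ :=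
  𝓜.Sbar T ω * (antideriv 𝓜.f (Y T ω + Δ ω) - antideriv 𝓜.f (Y T ω))

theorem measurable_blockCost (hY : 𝓜.IsImpact T Θ Y) (hΔ : Measurable[ℱ T] Δ) :
    Measurable[ℱ T] (𝓜.blockCost T Y Δ) := by
  have hF := 𝓜.impact.continuous_antideriv.measurable
  exact (𝓜.Sbar_adapted T).mul
    ((hF.comp ((hY.adapted T).add hΔ)).sub (hF.comp (hY.adapted T)))

/-- Both integrals are unchanged, with the same `J`; only the boundary term `S̄_T F(Y_T)` feels the
jump. -/
theorem IsProceeds.addTerminalJump (hY : 𝓜.IsImpact T Θ Y) (hL : 𝓜.IsProceeds T Y L)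
    (hΔ : Measurable[ℱ T] Δ) :
    𝓜.IsProceeds T (addTerminalJump T Y Δ)
      (addTerminalJump T L fun ω => -𝓜.blockCost T Y Δ ω) where
  adapted := adapted_addTerminalJump hL.adapted (measurable_blockCost hY hΔ).neg
  cadlag := hL.cadlag.addTerminalJump _
  eq := by
    obtain ⟨J, hJ, hLJ⟩ := hL.eq
    refine ⟨J, fun t ht => (hJ t ht).congr_of_lt fun u hu => funext fun ω => ?_, fun t ht => ?_⟩
    · rw [addTerminalJump_of_ne (hu.trans_le ht).ne]
    · filter_upwards [hLJ t ht] with ω hω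
      rw [integral_addTerminalJump T t Y Δ ω fun u y =>
        𝓜.Sbar u.toNNReal ω * (𝓜.f y * 𝓜.h y)]
      by_cases hT : t = T
      · subst hT
        rw [addTerminalJump_self, addTerminalJump_self, hω, blockCost]
        ring
      · rw [addTerminalJump_of_ne hT, addTerminalJump_of_ne hT, hω]

/-- A strategy followed by a block trade at maturity is a superhedging strategy if it meets the
payoff after that trade. -/
theorem isSuperhedge_addTerminalJump {Γ : Set (ℝ≥0 → Ω → ℝ)}
    (hΓ : StableUnderTerminalJump ℱ T Γ) (hΘ : Θ ∈ Γ) (hY : 𝓜.IsImpact T Θ Y)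
    (hL : 𝓜.IsProceeds T Y L) (hΔ : Measurable[ℱ T] Δ) {g₀ g₁ : ℝ → ℝ → ℝ} {b : ℝ}
    (h : ∀ᵐ ω ∂P,
      g₀ (𝓜.f (Y T ω + Δ ω) * 𝓜.Sbar T ω) (Y T ω + Δ ω) ≤ b + L T ω - 𝓜.blockCost T Y Δ ω ∧
      Θ T ω + Δ ω = g₁ (𝓜.f (Y T ω + Δ ω) * 𝓜.Sbar T ω) (Y T ω + Δ ω)) :
    ∃ β Θ', 𝓜.IsSuperhedge T Γ g₀ g₁ b β Θ' := by
  refine ⟨_, addTerminalJump T Θ Δ, hΓ Θ hΘ Δ hΔ, _, _, hY.addTerminalJump hΔ,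
    hL.addTerminalJump hY hΔ, fun _ _ => rfl, ?_⟩
  filter_upwards [h] with ω hω
  simp only [price, addTerminalJump_self]
  exact ⟨hω.1.trans_eq (by ring), hω.2⟩

theorem superhedgingPrice_le {Γ : Set (ℝ≥0 → Ω → ℝ)} {g₀ g₁ : ℝ → ℝ → ℝ} {b : ℝ}
    (h : ∃ β Θ, 𝓜.IsSuperhedge T Γ g₀ g₁ b β Θ) : 𝓜.superhedgingPrice T Γ g₀ g₁ ≤ b :=
  iInf₂_le b h

end Market

/-! ### Nearly optimal block trades. -/

/-- The total cost of meeting `(g₀, g₁)` by a block trade of size `θ`. -/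
noncomputable def blockTradeCost (f : ℝ → ℝ) (g₀ : ℝ → ℝ → ℝ) (s y θ : ℝ) : ℝ :=
  g₀ (s * (f (y + θ) / f y)) (y + θ) + s * ((antideriv f (y + θ) - antideriv f y) / f y)

theorem cashEquivalent_le {f : ℝ → ℝ} {g₀ g₁ : ℝ → ℝ → ℝ} {s y θ : ℝ}
    (hθ : θ = g₁ (s * (f (y + θ) / f y)) (y + θ)) :
    cashEquivalent f g₀ g₁ s y ≤ (blockTradeCost f g₀ s y θ : ℝ) :=
  iInf₂_le θ hθ

/-- Nearly optimal block trades can be chosen measurably, outside a null set. -/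
theorem exists_measurable_blockTrade {f : ℝ → ℝ} (hf : IsImpactFunction f) {g₀ g₁ : ℝ → ℝ → ℝ}
    (hg₀ : PayoffMeasurable g₀) (hg₁ : PayoffMeasurable g₁)
    (hfin : ∀ s y, 0 < s → cashEquivalent f g₀ g₁ s y ≠ ⊥ ∧ cashEquivalent f g₀ g₁ s y ≠ ⊤)
    (hH : PayoffMeasurable fun s y => (cashEquivalent f g₀ g₁ s y).toReal)
    (ν : Measure (Set.Ioi (0 : ℝ) × ℝ)) [IsFiniteMeasure ν] {ε : ℝ} (hε : 0 < ε) :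
    ∃ θ : Set.Ioi (0 : ℝ) × ℝ → ℝ, Measurable θ ∧ ∀ᵐ x ∂ν,
      θ x = g₁ (x.1 * (f (x.2 + θ x) / f x.2)) (x.2 + θ x) ∧
      blockTradeCost f g₀ x.1 x.2 (θ x) ≤ (cashEquivalent f g₀ g₁ x.1 x.2).toReal + ε := by
  have : StandardBorelSpace (Set.Ioi (0 : ℝ)) := measurableSet_Ioi.standardBorel
  have hfm := hf.continuous.measurable
  have hFm := hf.continuous_antideriv.measurable
  -- price and impact after the block trade
  let Φ : (Set.Ioi (0 : ℝ) × ℝ) × ℝ → Set.Ioi (0 : ℝ) × ℝ := fun z =>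
    (⟨z.1.1 * (f (z.1.2 + z.2) / f z.1.2),
      mul_pos z.1.1.2 (div_pos (hf.pos _) (hf.pos _))⟩, z.1.2 + z.2)
  have hs : Measurable fun z : (Set.Ioi (0 : ℝ) × ℝ) × ℝ => (z.1.1 : ℝ) :=
    measurable_subtype_coe.comp (measurable_fst.comp measurable_fst)
  have hy : Measurable fun z : (Set.Ioi (0 : ℝ) × ℝ) × ℝ => z.1.2 :=
    measurable_snd.comp measurable_fst
  have hyθ : Measurable fun z : (Set.Ioi (0 : ℝ) × ℝ) × ℝ => z.1.2 + z.2 :=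
    hy.add measurable_snd
  have hΦ : Measurable Φ :=
    (Measurable.subtype_mk (hs.mul ((hfm.comp hyθ).div (hfm.comp hy)))).prodMk hyθ
  refine exists_measurable_ae_mem ν
    (E := {z | z.2 = g₁ (Φ z).1 (Φ z).2} ∩
      {z | blockTradeCost f g₀ z.1.1 z.1.2 z.2 ≤
        (cashEquivalent f g₀ g₁ z.1.1 z.1.2).toReal + ε}) ?_ ?_
  · refine (measurableSet_eq_fun measurable_snd (hg₁.comp hΦ)).inter (measurableSet_le ?_ ?_)
    · exact (hg₀.comp hΦ).add (hs.mul (((hFm.comp hyθ).sub (hFm.comp hy)).div (hfm.comp hy)))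
    · exact (hH.comp measurable_fst).add_const ε
  · rintro ⟨⟨s, hs⟩, y⟩
    obtain ⟨hbot, htop⟩ := hfin s y hs
    -- Finiteness of `H` makes `H + ε` strictly larger, so the infimum provides an admissible trade
    -- below it.
    have hlt : cashEquivalent f g₀ g₁ s y <
        (((cashEquivalent f g₀ g₁ s y).toReal + ε : ℝ) : EReal) := by
      conv_lhs => rw [← EReal.coe_toReal htop hbot]
      exact EReal.coe_lt_coe (lt_add_of_pos_right _ hε)
    rw [cashEquivalent] at hlt
    simp only [iInf_lt_iff] at hlt
    obtain ⟨θ, hθ, hlt⟩ := hlt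
    exact ⟨θ, hθ, (EReal.coe_lt_coe_iff.1 hlt).le⟩

/-! ### The two price inequalities. -/

namespace Market

variable {𝓜 : Market P ℱ} {T : ℝ≥0}

/-- The jump `-Θ_T` liquidates the position. Trading `Θ_T` from the new state would restore the old
one, so it competes in `H`, and its cost cancels the liquidation proceeds. -/
theorem superhedgingPrice_cashEquivalent_le {Γ : Set (ℝ≥0 → Ω → ℝ)}
    (hΓ : StableUnderTerminalJump ℱ T Γ) (hadapted : ∀ Θ ∈ Γ, Adapted ℱ Θ) {g₀ g₁ : ℝ → ℝ → ℝ}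
    (hfin : ∀ s y, 0 < s →
      cashEquivalent 𝓜.f g₀ g₁ s y ≠ ⊥ ∧ cashEquivalent 𝓜.f g₀ g₁ s y ≠ ⊤) :
    𝓜.superhedgingPrice T Γ (fun s y => (cashEquivalent 𝓜.f g₀ g₁ s y).toReal) (fun _ _ => 0) ≤
      𝓜.superhedgingPrice T Γ g₀ g₁ := by
  refine le_iInf₂ fun b hb => ?_
  obtain ⟨β, Θ, hΘ, Y, L, hY, hL, hβ, hg⟩ := hb
  refine superhedgingPrice_le (isSuperhedge_addTerminalJump (Δ := fun ω => -Θ T ω) hΓ hΘ hY hL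
    (hadapted Θ hΘ T).neg ?_)
  filter_upwards [hg] with ω hω
  obtain ⟨hω₀, hω₁⟩ := hω
  refine ⟨?_, add_neg_cancel _⟩
  have hf := (𝓜.impact.pos (Y T ω + -Θ T ω)).ne'
  have hy : Y T ω + -Θ T ω + Θ T ω = Y T ω := by ring
  have hs : 𝓜.f (Y T ω + -Θ T ω) * 𝓜.Sbar T ω *
      (𝓜.f (Y T ω) / 𝓜.f (Y T ω + -Θ T ω)) = 𝓜.price Y T ω := by
    rw [price]
    field_simp
  have hle := cashEquivalent_le (f := 𝓜.f) (g₀ := g₀) (g₁ := g₁)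
    (s := 𝓜.f (Y T ω + -Θ T ω) * 𝓜.Sbar T ω) (y := Y T ω + -Θ T ω) (θ := Θ T ω)
    (by rw [hy, hs]; exact hω₁)
  obtain ⟨hbot, htop⟩ := hfin (𝓜.f (Y T ω + -Θ T ω) * 𝓜.Sbar T ω) (Y T ω + -Θ T ω)
    (mul_pos (𝓜.impact.pos _) (𝓜.Sbar_pos T ω))
  rw [← EReal.coe_toReal htop hbot, EReal.coe_le_coe_iff, blockTradeCost, hy, hs] at hle
  refine hle.trans ?_
  have hcost : 𝓜.f (Y T ω + -Θ T ω) * 𝓜.Sbar T ω *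
      ((antideriv 𝓜.f (Y T ω) - antideriv 𝓜.f (Y T ω + -Θ T ω)) / 𝓜.f (Y T ω + -Θ T ω)) =
      -𝓜.blockCost T Y (fun ω => -Θ T ω) ω := by
    rw [blockCost]
    field_simp
    ring
  rw [hcost, ← hβ T ω, ← sub_eq_add_neg]
  exact sub_le_sub_right hω₀ _

theorem superhedgingPrice_le_cashEquivalent [IsFiniteMeasure P] {Γ : Set (ℝ≥0 → Ω → ℝ)}
    (hΓ : StableUnderTerminalJump ℱ T Γ) {g₀ g₁ : ℝ → ℝ → ℝ}
    (hg₀ : PayoffMeasurable g₀) (hg₁ : PayoffMeasurable g₁)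
    (hfin : ∀ s y, 0 < s →
      cashEquivalent 𝓜.f g₀ g₁ s y ≠ ⊥ ∧ cashEquivalent 𝓜.f g₀ g₁ s y ≠ ⊤)
    (hH : PayoffMeasurable fun s y => (cashEquivalent 𝓜.f g₀ g₁ s y).toReal) :
    𝓜.superhedgingPrice T Γ g₀ g₁ ≤
      𝓜.superhedgingPrice T Γ (fun s y => (cashEquivalent 𝓜.f g₀ g₁ s y).toReal)
        (fun _ _ => 0) := by
  refine le_iInf₂ fun b hb => ?_
  obtain ⟨β, Θ, hΘ, Y, L, hY, hL, hβ, hg⟩ := hb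
  -- The surplus `c - b` over the capital `b` pays for the suboptimality of the selected trade.
  refine EReal.le_of_forall_lt_iff_le.1 fun c hc => ?_
  have hε : 0 < c - b := sub_pos.2 (EReal.coe_lt_coe_iff.1 hc)
  -- the state of the market just before the final block trade
  let Z : Ω → Set.Ioi (0 : ℝ) × ℝ := fun ω => (⟨𝓜.price Y T ω, 𝓜.price_pos Y T ω⟩, Y T ω)
  have hZ : Measurable[ℱ T] Z :=
    (Measurable.subtype_mk ((𝓜.impact.continuous.measurable.comp (hY.adapted T)).mul
      (𝓜.Sbar_adapted T))).prodMk (hY.adapted T)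
  have hZ' : Measurable Z := hZ.mono (ℱ.le T) le_rfl
  obtain ⟨θ, hθ, hsel⟩ :=
    exists_measurable_blockTrade 𝓜.impact hg₀ hg₁ hfin hH (P.map Z) hε
  refine superhedgingPrice_le (isSuperhedge_addTerminalJump (Δ := fun ω => θ (Z ω)) hΓ hΘ hY hL
    (hθ.comp hZ) ?_)
  filter_upwards [hg, ae_of_ae_map hZ'.aemeasurable hsel] with ω hω hsω
  obtain ⟨hω₀, hω₁⟩ := hω
  obtain ⟨hs₁, hs₀⟩ := hsω
  have hf := (𝓜.impact.pos (Y T ω)).ne'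
  have hs : 𝓜.price Y T ω * (𝓜.f (Y T ω + θ (Z ω)) / 𝓜.f (Y T ω)) =
      𝓜.f (Y T ω + θ (Z ω)) * 𝓜.Sbar T ω := by
    rw [price]
    field_simp
  have hcost : 𝓜.price Y T ω *
      ((antideriv 𝓜.f (Y T ω + θ (Z ω)) - antideriv 𝓜.f (Y T ω)) / 𝓜.f (Y T ω)) =
      𝓜.blockCost T Y (fun ω => θ (Z ω)) ω := by
    rw [price, blockCost]
    field_simp
  change θ (Z ω) = g₁ (𝓜.price Y T ω * (𝓜.f (Y T ω + θ (Z ω)) / 𝓜.f (Y T ω))) _ at hs₁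
  change blockTradeCost 𝓜.f g₀ (𝓜.price Y T ω) (Y T ω) (θ (Z ω)) ≤
    (cashEquivalent 𝓜.f g₀ g₁ (𝓜.price Y T ω) (Y T ω)).toReal + (c - b) at hs₀
  rw [hs] at hs₁
  rw [blockTradeCost, hs, hcost] at hs₀
  rw [hβ] at hω₀
  refine ⟨by linarith, ?_⟩
  rw [hω₁, zero_add]
  exact hs₁

end Market

/-! ### Constant `λ`. -/

/-- Since `f' = c f`, the product `f(x) e^(-cx)` has zero derivative, and it equals `1` at `0`. -/
theorem IsImpactFunction.eq_exp {f : ℝ → ℝ} (hf : IsImpactFunction f) {c : ℝ}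
    (hc : ∀ x, lam f x = c) (x : ℝ) : f x = Real.exp (c * x) := by
  have hd : Differentiable ℝ f := hf.contDiff.differentiable one_ne_zero
  have hderiv : ∀ x, HasDerivAt (fun x => f x * Real.exp (-(c * x))) 0 x := by
    intro x
    have h1 : deriv f x = c * f x := by
      have := hc x
      rwa [lam, div_eq_iff (hf.pos x).ne'] at this
    have h2 : HasDerivAt (fun x => Real.exp (-(c * x))) (Real.exp (-(c * x)) * -(c * 1)) x :=
      (((hasDerivAt_id x).const_mul c).neg).exp
    refine ((hd x).hasDerivAt.mul h2).congr_deriv ?_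
    rw [h1]
    ring
  have hconst := is_const_of_deriv_eq_zero (fun x => (hderiv x).differentiableAt)
    (fun x => (hderiv x).deriv) x 0
  simp only [hf.map_zero, mul_zero, neg_zero, Real.exp_zero, mul_one] at hconst
  rw [Real.exp_neg] at hconst
  exact (mul_inv_eq_one₀ (Real.exp_ne_zero _)).1 hconst

/-- For exponential `f` the relative impact of a trade does not depend on the impact before it. -/
theorem IsImpactFunction.cashEquivalent_eq {f : ℝ → ℝ} (hf : IsImpactFunction f) {c : ℝ}
    (hc : ∀ x, lam f x = c) {g₀ g₁ : ℝ → ℝ → ℝ}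
    (hg₀ : ∀ s y y', 0 < s → g₀ s y = g₀ s y') (hg₁ : ∀ s y y', 0 < s → g₁ s y = g₁ s y')
    (s y y' : ℝ) (hs : 0 < s) : cashEquivalent f g₀ g₁ s y = cashEquivalent f g₀ g₁ s y' := by
  have hadd : ∀ y θ, f (y + θ) = f y * f θ := by
    intro y θ
    rw [hf.eq_exp hc, hf.eq_exp hc y, hf.eq_exp hc θ, mul_add, Real.exp_add]
  have hratio : ∀ y θ, f (y + θ) / f y = f θ := fun y θ => by
    rw [hadd, mul_div_cancel_left₀ _ (hf.pos y).ne']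
  have hint : ∀ y θ, (antideriv f (y + θ) - antideriv f y) / f y = antideriv f θ := by
    intro y θ
    have h1 : antideriv f (y + θ) - antideriv f y = ∫ u in y..(y + θ), f u :=
      intervalIntegral.integral_interval_sub_left (hf.continuous.intervalIntegrable _ _)
        (hf.continuous.intervalIntegrable _ _)
    have h2 : ∫ u in y..(y + θ), f u = ∫ u in (0 : ℝ)..θ, f (y + u) := by
      rw [intervalIntegral.integral_comp_add_left f y, add_zero]
    rw [h1, h2]
    simp only [hadd]
    rw [intervalIntegral.integral_const_mul, mul_div_cancel_left₀ _ (hf.pos y).ne', antideriv]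
  unfold cashEquivalent
  refine iInf_congr fun θ => ?_
  -- The payoffs are independent of `y` only at positive prices.
  have hpos : 0 < s * f θ := mul_pos hs (hf.pos θ)
  rw [hratio, hratio, hint, hint, hg₀ _ (y + θ) (y' + θ) hpos, hg₁ _ (y + θ) (y' + θ) hpos]

end TransientImpact

open TransientImpact in
theorem mainTheorem8 {Ω : Type*} {mΩ : MeasurableSpace Ω} (P : Measure Ω) [IsProbabilityMeasure P]
    (ℱ : Filtration ℝ≥0 mΩ) (hℱ : UsualConditions P ℱ) (𝓜 : Market P ℱ) (T : ℝ≥0)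
    (Γ : Set (ℝ≥0 → Ω → ℝ)) (hΓ : IsStrategyClass ℱ T Γ) (hΓT : StableUnderTerminalJump ℱ T Γ)
    (g₀ g₁ : ℝ → ℝ → ℝ) (hg₀ : PayoffMeasurable g₀) (hg₁ : PayoffMeasurable g₁) :
    ((∀ s y, 0 < s → cashEquivalent 𝓜.f g₀ g₁ s y ≠ ⊥ ∧ cashEquivalent 𝓜.f g₀ g₁ s y ≠ ⊤) →
      PayoffMeasurable (fun s y => (cashEquivalent 𝓜.f g₀ g₁ s y).toReal) →
      𝓜.superhedgingPrice T Γ g₀ g₁ =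
        𝓜.superhedgingPrice T Γ (fun s y => (cashEquivalent 𝓜.f g₀ g₁ s y).toReal)
          (fun _ _ => 0)) ∧
    ((∃ c : ℝ, ∀ x, lam 𝓜.f x = c) →
      (∀ s y y', 0 < s → g₀ s y = g₀ s y') → (∀ s y y', 0 < s → g₁ s y = g₁ s y') →
      ∀ s y y', 0 < s → cashEquivalent 𝓜.f g₀ g₁ s y = cashEquivalent 𝓜.f g₀ g₁ s y') := by
  refine ⟨fun hfin hH => le_antisymm ?_ ?_, fun ⟨c, hc⟩ h₀ h₁ s y y' hs => ?_⟩
  · exact Market.superhedgingPrice_le_cashEquivalent hΓT hg₀ hg₁ hfin hH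
  · exact Market.superhedgingPrice_cashEquivalent_le hΓT (fun Θ hΘ => (hΓ Θ hΘ).1) hfin
  · exact 𝓜.impact.cashEquivalent_eq hc h₀ h₁ s y y' hs
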